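/- Let $\mathfrak H$ be a complex Hilbert space and let $S$ be a closed densely defined non-negative symmetric operator in $\mathfrak H$ that is not selfadjoint. For $z\in\mathbb C\setminus\{0\}$ with $\operatorname{Re} z\le 0$ let $$\mathfrak N_z:=\mathfrak H\ominus\operatorname{ran}(S-\bar z I)=\ker(S^*-zI)$$ be the defect subspace, and let $S_z$ be the extension of $S$ given by $$\operatorname{dom} S_z:=\operatorname{dom} S\dotplus\mathfrak N_z,\qquad S_z(f+\varphi):=Sf-z\varphi\quad(f\in\operatorname{dom} S,\ \varphi\in\mathfrak N_z).$$ (The sum is direct, so $S_z$ is well defined.) Dimensions are taken in $\mathbb N_0\cup\{\infty\}$, and the codimension $\operatorname{codim}\mathcal L$ of a subspace $\mathcal L\subset\mathfrak H$ is the dimension of $\mathfrak H/\overline{\mathcal L}$, equivalently of $\mathcal L^\perp$. A subspace $\mathcal L\subset\operatorname{dom}T$ is a core of a closed operator $T$ if the closure of $T{\upharpoonright}\mathcal L$ is $T$. i) If $\operatorname{Re} z<0$ and $\operatorname{Im} z\ne 0$, then $\operatorname{dom} S_z\cap\operatorname{dom} S_z^*$ is dense in $\mathfrak H$, but it is neither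 a core of $S_z$ nor of $S_z^*$. ii) If $a<0$, then $(\operatorname{dom} S_a\cap\operatorname{dom} S_a^*)^\perp=\mathfrak N_a$, and hence $$\operatorname{codim}(\operatorname{dom} S_a\cap\operatorname{dom} S_a^*)=\dim\mathfrak N_a\le\infty.$$ iii) Let $x\in\mathbb R\setminus\{0\}$. a) If $\operatorname{dom} S_{ix}\cap\operatorname{dom} S_{ix}^*$ is dense in $\mathfrak H$, then it is neither a core of $S_{ix}$ nor of $S_{ix}^*$. If $\dim\mathfrak N_{ix}<\infty$, then $\operatorname{dom} S_{ix}\cap\operatorname{dom} S_{ix}^*$ is dense in $\mathfrak H$ (and hence is neither a core of $S_{ix}$ nor of $S_{ix}^*$). b) If $\operatorname{dom} S^2=\{0\}$, then $\dim\mathfrak N_{ix}=\infty$, and therefore $$\dim(\operatorname{dom} S_{ix}\cap\operatorname{dom} S_{ix}^*)=\infty,\qquad \operatorname{codim}(\operatorname{dom} S_{ix}\cap\operatorname{dom} S_{ix}^*)=\infty.$$ -/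

import Mathlib

noncomputable section

open scoped ComplexConjugate

namespace UnboundedOp

variable {H : Type*} [NormedAddCommGroup H] [InnerProductSpace ℂ H]

/-- A closed densely defined non-negative symmetric operator `S` in `H`: the graph of `S` is
closed, `dom S` is dense, `(S f, g) = (f, S g)` and `(S f, f) ≥ 0` for `f, g ∈ dom S`.
(By symmetry `(S f, f)` is real.) -/
structure IsClosedNonnegSymmetric (S : H →ₗ.[ℂ] H) : Prop where
  isClosed : S.IsClosed
  dense_domain : Dense (S.domain : Set H)
  symmetric : S.IsFormalAdjoint S
  nonneg : ∀ f : S.domain, 0 ≤ (inner ℂ (S f) (f : H)).re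

/-- `ran (S - w I)`. -/
def shiftRange (S : H →ₗ.[ℂ] H) (w : ℂ) : Submodule ℂ H :=
  LinearMap.range (S.toFun - w • S.domain.subtype)

/-- The defect subspace `N_z = H ⊖ ran (S - z̄ I)`. -/
def defectSpace (S : H →ₗ.[ℂ] H) (z : ℂ) : Submodule ℂ H :=
  (shiftRange S (conj z))ᗮ

/-- Multiplication by `-z` on the defect subspace `N_z`. -/
def negMulOnDefect (S : H →ₗ.[ℂ] H) (z : ℂ) : H →ₗ.[ℂ] H :=
  LinearMap.toPMap (-z • (LinearMap.id : H →ₗ[ℂ] H)) (defectSpace S z)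

/-- `dom S ∩ N_z = {0}` if `Re z ≤ 0`, `z ≠ 0`. -/
theorem eq_zero_of_mem_domain_of_mem_defectSpace {S : H →ₗ.[ℂ] H}
    (hS : IsClosedNonnegSymmetric S) {z : ℂ} (hz : z ≠ 0) (hre : z.re ≤ 0)
    (f : S.domain) (hf : (f : H) ∈ defectSpace S z) : f = 0 := by
  have h1 : inner ℂ (S f - conj z • (f : H)) (f : H) = 0 :=
    (Submodule.mem_orthogonal _ _).1 hf _ ⟨f, rfl⟩
  rw [inner_sub_left, inner_smul_left, Complex.conj_conj, sub_eq_zero,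
    inner_self_eq_norm_sq_to_K] at h1
  have h2 : (inner ℂ (S f) (f : H)).im = 0 := by
    have h3 := hS.symmetric f f
    rw [← inner_conj_symm (f : H) (S f)] at h3
    exact Complex.conj_eq_iff_im.1 h3.symm
  have h4 := hS.nonneg f
  by_contra hne
  have hpos : 0 < ‖(f : H)‖ ^ 2 := by
    have : (f : H) ≠ 0 := fun h => hne (Subtype.ext h)
    positivity
  have e : ((‖(f : H)‖ : ℂ)) ^ 2 = ((‖(f : H)‖ ^ 2 : ℝ) : ℂ) := by push_cast; rfl
  have h1' : inner ℂ (S f) (f : H) = z * ((‖(f : H)‖ ^ 2 : ℝ) : ℂ) := by rw [← e]; exact h1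
  rw [h1'] at h2 h4
  rw [Complex.im_mul_ofReal] at h2
  rw [Complex.re_mul_ofReal] at h4
  have him : z.im = 0 := by
    rcases mul_eq_zero.1 h2 with h | h
    · exact h
    · exact absurd h hpos.ne'
  have hre0 : z.re = 0 := le_antisymm hre (by
    by_contra hlt
    exact absurd h4 (not_le.2 (mul_neg_of_neg_of_pos (not_le.1 hlt) hpos)))
  exact hz (Complex.ext hre0 him)

/-- The extension `S_z` of `S`, `z ≠ 0`, `Re z ≤ 0`: its domain is the direct sum
`dom S ∔ N_z`, and `S_z (f + φ) = S f - z φ` for `f ∈ dom S`, `φ ∈ N_z`. -/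
def extension (S : H →ₗ.[ℂ] H) (hS : IsClosedNonnegSymmetric S) (z : ℂ) (hz : z ≠ 0)
    (hre : z.re ≤ 0) : H →ₗ.[ℂ] H :=
  S.sup (negMulOnDefect S z) (by
    intro x y hxy
    have hx : x = 0 :=
      eq_zero_of_mem_domain_of_mem_defectSpace hS hz hre x (by rw [hxy]; exact y.2)
    have hy : y = 0 := Subtype.ext (by rw [← hxy, hx]; rfl)
    rw [hx, hy, LinearPMap.map_zero, LinearPMap.map_zero])

/-- `dom S² = {f ∈ dom S : S f ∈ dom S}`. -/
def sqDomain (S : H →ₗ.[ℂ] H) : Submodule ℂ H :=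
  (S.domain.comap S.toFun).map S.domain.subtype

/-- The square `S²` on its natural domain. -/
def square (S : H →ₗ.[ℂ] H) : H →ₗ.[ℂ] H :=
  S.comp (S.domRestrict (sqDomain S)) (by
    rintro ⟨x, ⟨⟨y, hy, rfl⟩, _⟩⟩
    exact hy)

/-- The dimension of a subspace, in `ℕ ∪ {∞}`. -/
def dim (L : Submodule ℂ H) : ℕ∞ :=
  Cardinal.toENat (Module.rank ℂ L)

/-- The codimension of a (not necessarily closed) subspace `L` of a Hilbert space, in `ℕ ∪ {∞}`:
the dimension of the quotient by the closure of `L`, i.e. of the orthogonal complement of `L`.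
In particular it is `0` iff `L` is dense. -/
def codim (L : Submodule ℂ H) : ℕ∞ :=
  Cardinal.toENat (Module.rank ℂ (H ⧸ L.topologicalClosure))

/-- `dom T ∩ dom T*`. -/
def domInter [CompleteSpace H] (T : H →ₗ.[ℂ] H) : Submodule ℂ H :=
  T.domain ⊓ T.adjoint.domain

end UnboundedOp

end

noncomputable section

open scoped ComplexConjugate

namespace UnboundedOp

open Filter Topology

variable {H : Type*} [NormedAddCommGroup H] [InnerProductSpace ℂ H]

/-! Let `P` be the orthogonal projection onto `N_z`. Testing the adjoint relation on `dom S` and on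
`N_z` separately shows that `f + φ` lies in `dom S_z*` exactly when `z̄ P f + (Re z) φ = 0`, and
then `S_z* (f + φ) = S f + z φ` (`mem_graph_adjoint_extension`).

If `Re z ≠ 0`, this determines `φ` from `f`: the intersection of the domains is the image of `dom S`
under `I - (z̄ / Re z) P`, and its orthogonal complement is the kernel of the adjoint operator,
which is `{0}` for nonreal `z` and `N_z` for real `z`. If `Re z = 0`, the intersection is `(dom S ∩
N_zᗮ) + N_z`, where `N_zᗮ = ran (S - z̄ I)`.

For the cores, let `Im z ≠ 0`. Then `φ` is a bounded function of `u = f + φ`, so `S_z* = S_z + 2K`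
on the intersection, with `K` a bounded skew-adjoint multiple of `P`. Both restrictions are
therefore closed, and a core would have to be a whole domain. Accretivity of `S_z`
(`domain_le_adjoint_domain`) reduces both cases to `dom S_z ⊆ dom S_z*`, which forces `P = 0`; but
`N_z = {0}` would make `S` selfadjoint (`isSelfAdjoint_of_defectSpace_eq_bot`). -/

/-! ### Closed linear relations, bounded perturbations and cores. -/

/-- If `G` is a closed linear relation and `G + B` is bounded below, then convergence of the second
components of a sequence in `G + B` implies convergence of the sequence in `G`. -/
theorem exists_tendsto_of_boundedBelow [CompleteSpace H] {G : Submodule ℂ (H × H)}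
    (hG : IsClosed (G : Set (H × H))) (B : H →L[ℂ] H) {c : ℝ} (hc : 0 < c)
    (hb : ∀ p ∈ G, c * ‖p.1‖ ≤ ‖p.2 + B p.1‖) {p : ℕ → H × H} (hp : ∀ n, p n ∈ G) {h : H}
    (hh : Tendsto (fun n => (p n).2 + B (p n).1) atTop (𝓝 h)) :
    ∃ q ∈ G, Tendsto p atTop (𝓝 q) := by
  have hcau : CauchySeq fun n => (p n).1 := by
    rw [Metric.cauchySeq_iff]
    intro ε hε
    obtain ⟨N, hN⟩ := Metric.cauchySeq_iff.1 hh.cauchySeq (c * ε) (by positivity)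
    refine ⟨N, fun m hm n hn => ?_⟩
    have h1 := hb _ (G.sub_mem (hp m) (hp n))
    have h2 := hN m hm n hn
    rw [dist_eq_norm] at h2 ⊢
    have h3 : (p m - p n).2 + B (p m - p n).1
        = (p m).2 + B (p m).1 - ((p n).2 + B (p n).1) := by
      simp only [Prod.fst_sub, Prod.snd_sub, map_sub]; abel
    rw [h3] at h1
    exact lt_of_mul_lt_mul_left (h1.trans_lt h2) hc.le
  obtain ⟨u, hu⟩ := cauchySeq_tendsto_of_complete hcau
  have h2 : Tendsto (fun n => (p n).2) atTop (𝓝 (h - B u)) := by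
    have := hh.sub ((B.continuous.tendsto u).comp hu)
    simpa using this
  have h3 : Tendsto p atTop (𝓝 (u, h - B u)) := hu.prodMk_nhds h2
  exact ⟨_, hG.mem_of_tendsto h3 (Eventually.of_forall hp), h3⟩

/-- The range of `G + B` for a closed linear relation `G` and a bounded operator `B`. -/
def perturbedRange (G : Submodule ℂ (H × H)) (B : H →L[ℂ] H) : Submodule ℂ H :=
  G.map (LinearMap.snd ℂ H H + B.toLinearMap ∘ₗ LinearMap.fst ℂ H H)

theorem mem_perturbedRange {G : Submodule ℂ (H × H)} {B : H →L[ℂ] H} {h : H} :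
    h ∈ perturbedRange G B ↔ ∃ p ∈ G, p.2 + B p.1 = h := Iff.rfl

theorem isClosed_perturbedRange [CompleteSpace H] {G : Submodule ℂ (H × H)}
    (hG : IsClosed (G : Set (H × H))) (B : H →L[ℂ] H) {c : ℝ} (hc : 0 < c)
    (hb : ∀ p ∈ G, c * ‖p.1‖ ≤ ‖p.2 + B p.1‖) :
    IsClosed (perturbedRange G B : Set H) := by
  refine IsSeqClosed.isClosed fun x h hx hh => ?_
  choose p hp hpx using fun n => mem_perturbedRange.1 (hx n)
  have hh' : Tendsto (fun n => (p n).2 + B (p n).1) atTop (𝓝 h) := by simpa only [hpx] using hh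
  obtain ⟨q, hq, hpq⟩ := exists_tendsto_of_boundedBelow hG B hc hb hp hh'
  refine mem_perturbedRange.2 ⟨q, hq, tendsto_nhds_unique ?_ hh'⟩
  exact ((by fun_prop : Continuous fun p : H × H => p.2 + B p.1).tendsto q).comp hpq

/-- A closed linear relation contains its double adjoint. -/
theorem mem_of_mem_adjoint_adjoint [CompleteSpace H] {G : Submodule ℂ (H × H)}
    (hG : IsClosed (G : Set (H × H))) {p : H × H} (hp : p ∈ G.adjoint.adjoint) : p ∈ G := by
  let e := (WithLp.prodContinuousLinearEquiv 2 ℂ H H)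
  let G' : Submodule ℂ (WithLp 2 (H × H)) := G.comap e.toLinearMap
  have hG' : IsClosed (G' : Set (WithLp 2 (H × H))) := hG.preimage e.continuous
  have hmem : e.symm p ∈ G'ᗮᗮ := by
    rw [Submodule.mem_orthogonal]
    intro w hw
    -- The adjoint relation is the orthogonal complement of the graph, rotated by `(a, b) ↦ (b,
    -- -a)`; the claim thus becomes `Gᗮᗮ = G` in the Hilbert space product.
    have hw' : (w.snd, -w.fst) ∈ G.adjoint := by
      rw [Submodule.mem_adjoint_iff]
      intro a b hab
      have := (Submodule.mem_orthogonal _ _).1 hw (e.symm (a, b)) (by simpa [G'] using hab)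
      rw [WithLp.prod_inner_apply] at this
      simpa [e, add_comm] using this
    have := (Submodule.mem_adjoint_iff _ _).1 hp _ _ hw'
    rw [WithLp.prod_inner_apply]
    have h2 : inner ℂ w.fst p.1 + inner ℂ w.snd p.2 = 0 := by
      rw [inner_neg_left] at this
      linear_combination -this
    simpa [e] using h2
  have : CompleteSpace G' := hG'.completeSpace_coe
  rw [Submodule.orthogonal_orthogonal] at hmem
  simpa [G'] using hmem

/-- A core on which the operator has a closed restriction contains the domain. -/
theorem domain_le_of_hasCore {T : H →ₗ.[ℂ] H} {L : Submodule ℂ H} (h : T.HasCore L)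
    (hcl : IsClosed {p : H × H | p ∈ T.graph ∧ p.1 ∈ L}) : T.domain ≤ L := by
  have hgr : ((T.domRestrict L).graph : Set (H × H)) = {p : H × H | p ∈ T.graph ∧ p.1 ∈ L} := by
    ext p
    constructor
    · intro hp
      refine ⟨LinearPMap.le_graph_of_le LinearPMap.domRestrict_le hp, ?_⟩
      exact (LinearPMap.mem_domain_of_mem_graph hp).1
    · rintro ⟨hp, hL⟩
      obtain ⟨y, hy1, hy2⟩ := (LinearPMap.mem_graph_iff _).1 hp
      refine (LinearPMap.mem_graph_iff _).2 ⟨⟨p.1, hL, hy1 ▸ y.2⟩, rfl, ?_⟩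
      rw [← hy2]
      exact LinearPMap.domRestrict_apply hy1.symm
  have hc : (T.domRestrict L).IsClosed := by
    rw [LinearPMap.IsClosed, hgr]; exact hcl
  have heq : (T.domRestrict L).closure = T.domRestrict L := by
    apply LinearPMap.eq_of_eq_graph
    rw [← hc.isClosable.graph_closure_eq_closure_graph]
    exact _root_.IsClosed.submodule_topologicalClosure_eq hc
  have h2 := h.closure_eq
  rw [heq] at h2
  intro x hx
  rw [← h2] at hx
  exact hx.1

/-! ### Closed accretive operators that differ from their adjoint by a bounded operator. -/

section Accretive

variable [CompleteSpace H] {T : H →ₗ.[ℂ] H}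

/-- Since `T* = T + K` on the common domain, the restricted graph is the graph of `T` intersected
with the preimage of the closed graph of `T*` under the continuous map `(u, v) ↦ (u, v + K u)`. The
next lemma exchanges `T` and `T*`. -/
theorem isClosed_restrict_domInter (hT : T.IsClosed) (hd : Dense (T.domain : Set H))
    (K : H →L[ℂ] H) (hK : ∀ u v w, (u, v) ∈ T.graph → (u, w) ∈ T.adjoint.graph → w = v + K u) :
    IsClosed {p : H × H | p ∈ T.graph ∧ p.1 ∈ domInter T} := by
  have h1 : {p : H × H | p ∈ T.graph ∧ p.1 ∈ domInter T}
      = (T.graph : Set (H × H)) ∩ (fun p : H × H => (p.1, p.2 + K p.1)) ⁻¹' (T.adjoint.graph : Set (H × H)) := by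
    ext ⟨u, v⟩
    constructor
    · rintro ⟨h1, h2⟩
      have h3 := T.adjoint.mem_graph ⟨u, h2.2⟩
      rw [hK u v _ h1 h3] at h3
      exact ⟨h1, h3⟩
    · rintro ⟨h1, h2⟩
      exact ⟨h1, LinearPMap.mem_domain_of_mem_graph h1, LinearPMap.mem_domain_of_mem_graph h2⟩
  rw [h1]
  exact hT.inter ((LinearPMap.adjoint_isClosed hd).preimage (by fun_prop))

theorem isClosed_restrict_adjoint_domInter (hT : T.IsClosed) (hd : Dense (T.domain : Set H))
    (K : H →L[ℂ] H) (hK : ∀ u v w, (u, v) ∈ T.graph → (u, w) ∈ T.adjoint.graph → w = v + K u) :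
    IsClosed {p : H × H | p ∈ T.adjoint.graph ∧ p.1 ∈ domInter T} := by
  have h1 : {p : H × H | p ∈ T.adjoint.graph ∧ p.1 ∈ domInter T}
      = (T.adjoint.graph : Set (H × H)) ∩ (fun p : H × H => (p.1, p.2 - K p.1)) ⁻¹' (T.graph : Set (H × H)) := by
    ext ⟨u, v⟩
    constructor
    · rintro ⟨h1, h2⟩
      have h3 := T.mem_graph ⟨u, h2.1⟩
      have h4 := hK u _ v h3 h1
      refine ⟨h1, ?_⟩
      rw [Set.mem_preimage, h4, add_sub_cancel_right]
      exact h3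
    · rintro ⟨h1, h2⟩
      exact ⟨h1, LinearPMap.mem_domain_of_mem_graph h2, LinearPMap.mem_domain_of_mem_graph h1⟩
  rw [h1]
  exact (LinearPMap.adjoint_isClosed hd).inter (hT.preimage (by fun_prop))

/-- A closed accretive operator `T` whose adjoint is `T + 2 K` on a smaller domain, with `K` bounded
and skew-adjoint, satisfies `dom T ⊆ dom T*`. -/
theorem domain_le_adjoint_domain (hT : T.IsClosed) (hd : Dense (T.domain : Set H))
    (hacc : ∀ p ∈ T.graph, 0 ≤ (inner ℂ p.2 p.1).re) (K : H →L[ℂ] H)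
    (hskew : ∀ x y, inner ℂ (K x) y = -inner ℂ x (K y))
    (hK : ∀ u v w, (u, v) ∈ T.graph → (u, w) ∈ T.adjoint.graph → w = v + (2 : ℂ) • K u)
    (hle : T.adjoint.domain ≤ T.domain) : T.domain ≤ T.adjoint.domain := by
  have hKre : ∀ x, (inner ℂ (K x) x).re = 0 := by
    intro x
    have h1 := congrArg Complex.re (hskew x x)
    rw [← inner_conj_symm x (K x), Complex.neg_re, Complex.conj_re] at h1
    linarith
  have hre : ∀ x : H, (inner ℂ x x).re = ‖x‖ ^ 2 := fun x => by
    have := inner_self_eq_norm_sq (𝕜 := ℂ) x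
    simpa using this
  have hpre : ∀ u w, (u, w) ∈ T.adjoint.graph →
      ∃ v, (u, v) ∈ T.graph ∧ w = v + (2 : ℂ) • K u := by
    intro u w hp
    have h3 := T.mem_graph ⟨u, hle (LinearPMap.mem_domain_of_mem_graph hp)⟩
    exact ⟨_, h3, hK u _ w h3 hp⟩
  let B : H →L[ℂ] H := ContinuousLinearMap.id ℂ H - K
  -- On `dom T*` the operator `T* + I - K` equals `T + K + I`; `K` contributes nothing to the real
  -- part of the form and `T` contributes a non-negative term.
  have hb : ∀ p ∈ T.adjoint.graph, 1 * ‖p.1‖ ≤ ‖p.2 + B p.1‖ := by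
    rintro ⟨u, w⟩ hp
    obtain ⟨v, hv, rfl⟩ := hpre _ _ hp
    have h1 : v + (2 : ℂ) • K u + B u = v + K u + u := by
      simp only [B, sub_apply, ContinuousLinearMap.id_apply, two_smul]; abel
    have h2 : ‖u‖ ^ 2 ≤ (inner ℂ (v + K u + u) u).re := by
      rw [inner_add_left, inner_add_left, Complex.add_re, Complex.add_re, hKre, hre]
      have := hacc _ hv
      dsimp only at this
      linarith
    have h3 : (inner ℂ (v + K u + u) u).re ≤ ‖v + K u + u‖ * ‖u‖ :=
      re_inner_le_norm (𝕜 := ℂ) _ _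
    dsimp only
    rw [h1, one_mul]
    rcases (norm_nonneg u).eq_or_lt with h0 | h0
    · rw [← h0]; exact norm_nonneg _
    · exact le_of_mul_le_mul_right (by nlinarith) h0
  have hker : ∀ d, (d, -K d - d) ∈ T.graph → d = 0 := by
    intro d hdm
    have h1 := hacc _ hdm
    dsimp only at h1
    rw [inner_sub_left, inner_neg_left, Complex.sub_re, Complex.neg_re, hKre, hre] at h1
    have : ‖d‖ ^ 2 = 0 := le_antisymm (by linarith) (sq_nonneg _)
    simpa using this
  -- A vector `w` orthogonal to the range of `T* + I - K` lies in `dom T** = dom T` with `T w = -K w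
  -- - w`, which accretivity allows only for `w = 0`.
  have htop : perturbedRange T.adjoint.graph B = ⊤ := by
    have hcl := isClosed_perturbedRange (LinearPMap.adjoint_isClosed hd) B one_pos hb
    have : CompleteSpace (perturbedRange T.adjoint.graph B) := hcl.completeSpace_coe
    rw [← Submodule.orthogonal_eq_bot_iff, Submodule.eq_bot_iff]
    intro w hw
    apply hker
    apply mem_of_mem_adjoint_adjoint hT
    rw [← LinearPMap.adjoint_graph_eq_graph_adjoint hd, Submodule.mem_adjoint_iff]
    intro a b hab
    have h1 := (Submodule.mem_orthogonal _ _).1 hw _ (mem_perturbedRange.2 ⟨_, hab, rfl⟩)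
    simp only [B, sub_apply, ContinuousLinearMap.id_apply, inner_add_left,
      inner_sub_left] at h1
    rw [inner_sub_right, inner_neg_right, ← hskew]
    linear_combination h1
  intro u hu
  have hug := T.mem_graph ⟨u, hu⟩
  set v := T ⟨u, hu⟩
  obtain ⟨⟨u', w⟩, hp, h1⟩ := mem_perturbedRange.1
    (htop ▸ Submodule.mem_top : v + K u + u ∈ perturbedRange T.adjoint.graph B)
  obtain ⟨v', hv', rfl⟩ := hpre _ _ hp
  simp only [B, sub_apply, ContinuousLinearMap.id_apply, two_smul] at h1
  -- `T + K + I` is injective on `dom T`, and its restriction to `dom T*` is already onto, so `u` is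
  -- the preimage `u'` found in `dom T*`.
  have h2 : u - u' = 0 := by
    apply hker
    have h3 := T.graph.sub_mem hug hv'
    have h4 : v - v' = -K (u - u') - (u - u') := by
      rw [map_sub]
      have : v = v' + (K u' + K u') + (u' - K u') - K u - u := by rw [h1]; abel
      rw [this]; abel
    rw [← h4]
    exact h3
  rw [sub_eq_zero.1 h2]
  exact LinearPMap.mem_domain_of_mem_graph hp

/-- If `T` is closed and accretive and `T* = T + 2 K` on `dom T ∩ dom T*`, with `K` bounded and
skew-adjoint, then `dom T ∩ dom T*` is a core of neither `T` nor `T*` unless `dom T ⊆ dom T*`. -/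
theorem not_hasCore_domInter (hT : T.IsClosed) (hd : Dense (T.domain : Set H))
    (hacc : ∀ p ∈ T.graph, 0 ≤ (inner ℂ p.2 p.1).re) (K : H →L[ℂ] H)
    (hskew : ∀ x y, inner ℂ (K x) y = -inner ℂ x (K y))
    (hK : ∀ u v w, (u, v) ∈ T.graph → (u, w) ∈ T.adjoint.graph → w = v + (2 : ℂ) • K u)
    (hne : ¬ T.domain ≤ T.adjoint.domain) :
    ¬ T.HasCore (domInter T) ∧ ¬ T.adjoint.HasCore (domInter T) := by
  refine ⟨fun h => hne ?_, fun h => hne ?_⟩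
  · exact (domain_le_of_hasCore h
      (isClosed_restrict_domInter hT hd ((2 : ℂ) • K) hK)).trans inf_le_right
  · exact domain_le_adjoint_domain hT hd hacc K hskew hK ((domain_le_of_hasCore h
      (isClosed_restrict_adjoint_domInter hT hd ((2 : ℂ) • K) hK)).trans inf_le_left)

end Accretive

/-! ### Defect spaces of non-negative symmetric operators. -/

section Symmetric

variable {S : H →ₗ.[ℂ] H}

theorem mem_defectSpace {z : ℂ} {φ : H} :
    φ ∈ defectSpace S z ↔ ∀ f : S.domain, inner ℂ (S f) φ = z * inner ℂ (f : H) φ := by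
  rw [defectSpace, Submodule.mem_orthogonal]
  constructor
  · intro h f
    have h1 : inner ℂ (S f - conj z • (f : H)) φ = 0 := h _ ⟨f, rfl⟩
    rw [inner_sub_left, inner_smul_left, Complex.conj_conj] at h1
    exact sub_eq_zero.1 h1
  · rintro h _ ⟨f, rfl⟩
    change inner ℂ (S f - conj z • (f : H)) φ = 0
    rw [inner_sub_left, inner_smul_left, Complex.conj_conj, h f, sub_self]

theorem inner_map_of_mem_defectSpace {z : ℂ} {φ : H} (hφ : φ ∈ defectSpace S z) (f : S.domain) :
    inner ℂ φ (S f) = conj z * inner ℂ φ (f : H) := by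
  rw [← inner_conj_symm, mem_defectSpace.1 hφ f, map_mul, inner_conj_symm]

theorem im_inner_map_self (hS : IsClosedNonnegSymmetric S) (f : S.domain) :
    (inner ℂ (S f) (f : H)).im = 0 := by
  have h3 := hS.symmetric f f
  rw [← inner_conj_symm (f : H) (S f)] at h3
  exact Complex.conj_eq_iff_im.1 h3.symm

/-- A non-negative operator minus a number in the left half-plane is bounded below. -/
theorem norm_le_norm_sub_smul (hS : IsClosedNonnegSymmetric S) {w : ℂ} (hw : w.re ≤ 0)
    (f : S.domain) : ‖w‖ * ‖(f : H)‖ ≤ ‖S f - w • (f : H)‖ := by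
  have h1 := norm_sub_sq (𝕜 := ℂ) (S f) (w • (f : H))
  have h2 : (inner ℂ (S f) (w • (f : H))).re ≤ 0 := by
    rw [inner_smul_right, Complex.mul_re, im_inner_map_self hS f, mul_zero, sub_zero]
    exact mul_nonpos_of_nonpos_of_nonneg hw (hS.nonneg f)
  rw [← norm_smul]
  refine le_of_sq_le_sq ?_ (norm_nonneg _)
  rw [h1]
  have h3 : RCLike.re (inner ℂ (S f) (w • (f : H))) ≤ 0 := h2
  nlinarith [sq_nonneg ‖S f‖]

theorem isClosed_shiftRange [CompleteSpace H] (hS : IsClosedNonnegSymmetric S) {w : ℂ}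
    (hw0 : w ≠ 0) (hw : w.re ≤ 0) : IsClosed (shiftRange S w : Set H) := by
  have h1 : shiftRange S w = perturbedRange S.graph (-(w • ContinuousLinearMap.id ℂ H)) := by
    ext h
    rw [mem_perturbedRange]
    constructor
    · rintro ⟨f, rfl⟩
      exact ⟨_, S.mem_graph f, (sub_eq_add_neg _ _).symm⟩
    · rintro ⟨p, hp, rfl⟩
      obtain ⟨f, hf1, hf2⟩ := (LinearPMap.mem_graph_iff _).1 hp
      rw [← hf1, ← hf2]
      exact ⟨f, sub_eq_add_neg _ _⟩
  rw [h1]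
  refine isClosed_perturbedRange hS.isClosed _ (norm_pos_iff.2 hw0) ?_
  intro p hp
  obtain ⟨f, hf1, hf2⟩ := (LinearPMap.mem_graph_iff _).1 hp
  rw [← hf1, ← hf2]
  have := norm_le_norm_sub_smul hS hw f
  rwa [sub_eq_add_neg] at this

theorem shiftRange_eq_orthogonal [CompleteSpace H] (hS : IsClosedNonnegSymmetric S) {z : ℂ}
    (hz : z ≠ 0) (hre : z.re ≤ 0) : shiftRange S (conj z) = (defectSpace S z)ᗮ := by
  have hcl := isClosed_shiftRange hS (w := conj z) (by simpa using hz) (by simpa using hre)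
  have : CompleteSpace (shiftRange S (conj z)) := hcl.completeSpace_coe
  rw [defectSpace, Submodule.orthogonal_orthogonal]

theorem exists_sub_smul_eq_of_defectSpace_eq_bot [CompleteSpace H]
    (hS : IsClosedNonnegSymmetric S) {z : ℂ} (hz : z ≠ 0) (hre : z.re ≤ 0)
    (h : defectSpace S z = ⊥) (x : H) : ∃ f : S.domain, S f - conj z • (f : H) = x := by
  have h1 := shiftRange_eq_orthogonal hS hz hre
  rw [h, Submodule.bot_orthogonal_eq_top] at h1
  have h2 : x ∈ shiftRange S (conj z) := h1 ▸ Submodule.mem_top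
  exact h2

/-- Vanishing of the defect space is stable under small changes of the parameter. -/
theorem defectSpace_eq_bot_of_norm_sub_lt [CompleteSpace H] (hS : IsClosedNonnegSymmetric S)
    {z w : ℂ} (hz : z ≠ 0) (hre : z.re ≤ 0) (h : defectSpace S z = ⊥) (hw : ‖z - w‖ < ‖z‖) :
    defectSpace S w = ⊥ := by
  rw [Submodule.eq_bot_iff]
  intro φ hφ
  obtain ⟨f, hf⟩ := exists_sub_smul_eq_of_defectSpace_eq_bot hS hz hre h φ
  have h1 := norm_le_norm_sub_smul hS (w := conj z) (by simpa using hre) f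
  rw [hf, RCLike.norm_conj] at h1
  -- Replacing the first `φ` by `S f - z̄ f` yields `‖φ‖ ≤ |z - w| ‖f‖`, while the lower bound gives
  -- `|z| ‖f‖ ≤ ‖φ‖`.
  have h2 : inner ℂ φ φ = (w - z) * inner ℂ (f : H) φ := by
    nth_rewrite 1 [← hf]
    rw [inner_sub_left, inner_smul_left, Complex.conj_conj, mem_defectSpace.1 hφ f]
    ring
  have h3 : ‖φ‖ * ‖φ‖ ≤ ‖z - w‖ * (‖(f : H)‖ * ‖φ‖) := by
    rw [← inner_self_eq_norm_mul_norm (𝕜 := ℂ), h2]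
    refine (RCLike.re_le_norm _).trans ?_
    rw [norm_mul, norm_sub_rev]
    gcongr
    exact norm_inner_le_norm _ _
  by_contra hne
  have hφp : 0 < ‖φ‖ := norm_pos_iff.2 hne
  have h4 : ‖φ‖ ≤ ‖z - w‖ * ‖(f : H)‖ := by
    refine le_of_mul_le_mul_right (by linarith) hφp
  have hfp : 0 < ‖(f : H)‖ := by
    refine (norm_nonneg _).lt_of_ne fun h0 => ?_
    rw [← h0, mul_zero] at h4
    exact absurd h4 (not_le.2 hφp)
  have := mul_lt_mul_of_pos_right hw hfp
  linarith

/-- Two perturbation steps carry a trivial defect space to a negative real point `-t`. There `S + t`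
is onto and `N_{-t} = {0}`, so every element of `dom S*` is in `dom S`. -/
theorem isSelfAdjoint_of_defectSpace_eq_bot [CompleteSpace H] (hS : IsClosedNonnegSymmetric S)
    {z : ℂ} (hz : z ≠ 0) (hre : z.re ≤ 0) (h : defectSpace S z = ⊥) : IsSelfAdjoint S := by
  obtain ⟨t, ht, hbot⟩ : ∃ t : ℝ, 0 < t ∧ defectSpace S (-t : ℂ) = ⊥ := by
    have hn : 0 < ‖z‖ := norm_pos_iff.2 hz
    -- The shift by `‖z‖ / 2` enters the open left half-plane while staying within the admissible
    -- radius `‖z‖`.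
    set z₁ : ℂ := z - (‖z‖ / 2 : ℝ) with hz₁
    have hre₁ : z₁.re < 0 := by
      rw [hz₁, Complex.sub_re, Complex.ofReal_re]; linarith
    have hz₁0 : z₁ ≠ 0 := fun h0 => by rw [h0] at hre₁; simp at hre₁
    have h1 : defectSpace S z₁ = ⊥ := by
      refine defectSpace_eq_bot_of_norm_sub_lt hS hz hre h ?_
      rw [hz₁, sub_sub_cancel, Complex.norm_of_nonneg (by positivity)]
      linarith
    -- The real part of `z₁` is at distance `|Im z₁|`, which is less than `|z₁|` because `Re z₁ <
    -- 0`.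
    refine ⟨-z₁.re, by linarith, defectSpace_eq_bot_of_norm_sub_lt hS hz₁0 hre₁.le h1 ?_⟩
    refine lt_of_pow_lt_pow_left₀ 2 (norm_nonneg _) ?_
    rw [← Complex.normSq_eq_norm_sq, ← Complex.normSq_eq_norm_sq, Complex.normSq_apply,
      Complex.normSq_apply]
    simp
    nlinarith
  rw [LinearPMap.isSelfAdjoint_def]
  have hle : S ≤ S.adjoint := LinearPMap.IsFormalAdjoint.le_adjoint hS.dense_domain hS.symmetric
  refine (LinearPMap.eq_of_le_of_domain_eq hle (le_antisymm hle.1 fun g hg => ?_)).symm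
  obtain ⟨f, hf⟩ := exists_sub_smul_eq_of_defectSpace_eq_bot hS (z := (-t : ℂ))
    (by simpa using ht.ne') (by simpa using ht.le) hbot (S.adjoint ⟨g, hg⟩ + (t : ℂ) • g)
  have hc : conj (-t : ℂ) = -t := by simp
  rw [hc, neg_smul, sub_neg_eq_add] at hf
  have h1 : g - f ∈ defectSpace S (-t : ℂ) := by
    rw [mem_defectSpace]
    intro k
    have h2 := (LinearPMap.adjoint_isFormalAdjoint hS.dense_domain).symm k ⟨g, hg⟩
    dsimp only at h2
    rw [inner_sub_right, h2, hS.symmetric k f, inner_sub_right,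
      eq_sub_of_add_eq hf, inner_sub_right, inner_add_right, inner_smul_right, inner_smul_right]
    ring
  rw [hbot, Submodule.mem_bot, sub_eq_zero] at h1
  rw [h1]
  exact f.2

end Symmetric

/-! ### The extension `S_z`, its adjoint, and the core statements. -/

section Extension

variable {S : H →ₗ.[ℂ] H} (hS : IsClosedNonnegSymmetric S) {z : ℂ} (hz : z ≠ 0) (hre : z.re ≤ 0)

theorem mem_graph_extension {u v : H} : (u, v) ∈ (extension S hS z hz hre).graph ↔
    ∃ f : S.domain, ∃ φ ∈ defectSpace S z, u = f + φ ∧ v = S f - z • φ := by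
  have key : ∀ (f : S.domain) (φ : H) (hφ : φ ∈ defectSpace S z)
      (x : (extension S hS z hz hre).domain), (f : H) + φ = x →
      extension S hS z hz hre x = S f - z • φ := by
    intro f φ hφ x hx
    refine (LinearPMap.sup_apply _ f (⟨φ, hφ⟩ : (negMulOnDefect S z).domain) x hx).trans ?_
    rw [sub_eq_add_neg, ← neg_smul]
    rfl
  constructor
  · intro h
    obtain ⟨x, hx1, hx2⟩ := (LinearPMap.mem_graph_iff _).1 h
    obtain ⟨f, hf, φ, hφ, hfφ⟩ := Submodule.mem_sup.1 x.2
    exact ⟨⟨f, hf⟩, φ, hφ, by rw [hfφ]; exact hx1.symm,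
      hx2.symm.trans (key ⟨f, hf⟩ φ hφ x hfφ)⟩
  · rintro ⟨f, φ, hφ, rfl, rfl⟩
    exact (LinearPMap.mem_graph_iff _).2
      ⟨⟨_, Submodule.add_mem_sup f.2 hφ⟩, rfl, key f φ hφ _ rfl⟩

theorem dense_domain_extension : Dense ((extension S hS z hz hre).domain : Set H) :=
  hS.dense_domain.mono (LinearPMap.left_le_sup _ _ _).1

/-- The extension `S_z` is accretive. -/
theorem extension_accretive (p : H × H) (hp : p ∈ (extension S hS z hz hre).graph) :
    0 ≤ (inner ℂ p.2 p.1).re := by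
  obtain ⟨f, φ, hφ, h1, h2⟩ := (mem_graph_extension hS hz hre (u := p.1) (v := p.2)).1 hp
  rw [h1, h2]
  -- The cross terms form a number minus its conjugate, so they have no real part.
  have e : inner ℂ (S f - z • φ) ((f : H) + φ) = inner ℂ (S f) (f : H)
      + (z * inner ℂ (f : H) φ - conj (z * inner ℂ (f : H) φ)) - conj z * inner ℂ φ φ := by
    rw [inner_sub_left, inner_add_right, inner_add_right, inner_smul_left, inner_smul_left,
      mem_defectSpace.1 hφ f, map_mul, inner_conj_symm]
    ring
  have hφφ : inner ℂ φ φ = ((‖φ‖ ^ 2 : ℝ) : ℂ) := by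
    rw [inner_self_eq_norm_sq_to_K]; push_cast; rfl
  rw [e, hφφ, Complex.sub_re, Complex.add_re, Complex.sub_re, Complex.conj_re, sub_self,
    Complex.re_mul_ofReal, Complex.conj_re]
  have := hS.nonneg f
  nlinarith [sq_nonneg ‖φ‖]

variable [CompleteSpace H]

instance (z : ℂ) : CompleteSpace (defectSpace S z) :=
  (Submodule.isClosed_orthogonal _).completeSpace_coe

/-- The orthogonal projection onto the defect space. -/
def defectProj (S : H →ₗ.[ℂ] H) (z : ℂ) : H →L[ℂ] H := (defectSpace S z).starProjection

theorem defectProj_mem (x : H) : defectProj S z x ∈ defectSpace S z :=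
  Submodule.starProjection_apply_mem _ _

theorem defectProj_eq_self_iff {x : H} : defectProj S z x = x ↔ x ∈ defectSpace S z :=
  Submodule.starProjection_eq_self_iff

theorem inner_defectProj_left (x y : H) :
    inner ℂ (defectProj S z x) y = inner ℂ x (defectProj S z y) :=
  Submodule.starProjection_isSymmetric _ x y

theorem inner_defectProj_right_of_mem {φ : H} (hφ : φ ∈ defectSpace S z) (x : H) :
    inner ℂ φ (defectProj S z x) = inner ℂ φ x := by
  rw [← inner_defectProj_left, defectProj_eq_self_iff.2 hφ]

theorem defectProj_eq_zero_iff {x : H} : defectProj S z x = 0 ↔ x ∈ (defectSpace S z)ᗮ :=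
  Submodule.starProjection_apply_eq_zero_iff _

theorem defectProj_sub_smul (f : S.domain) : defectProj S z (S f - conj z • (f : H)) = 0 :=
  defectProj_eq_zero_iff.2 (Submodule.le_orthogonal_orthogonal _ ⟨f, rfl⟩)

/-- The bounded map `Q (u, v) = (I - P)(v - z̄ u)` recovers `S f - z̄ f` from a point of the graph.
Convergence in the graph hence forces convergence of `f` and `S f` by the lower bound, and `φ`
converges as the difference. -/
theorem extension_isClosed : (extension S hS z hz hre).IsClosed := by
  refine IsSeqClosed.isClosed fun x p hx hxp => ?_
  choose f φ hφ h1 h2 using fun n => (mem_graph_extension hS hz hre (u := (x n).1)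
    (v := (x n).2)).1 (hx n)
  let Q : H × H →L[ℂ] H := (ContinuousLinearMap.id ℂ H - defectProj S z).comp
    (ContinuousLinearMap.snd ℂ H H - conj z • ContinuousLinearMap.fst ℂ H H)
  have hQ : ∀ n, Q (x n) = S (f n) - conj z • (f n : H) := by
    intro n
    have e : (x n).2 - conj z • (x n).1
        = (S (f n) - conj z • (f n : H)) - (z + conj z) • φ n := by
      rw [h1, h2, smul_add, add_smul]; abel
    change (x n).2 - conj z • (x n).1 - defectProj S z ((x n).2 - conj z • (x n).1) = _
    rw [e, map_sub, defectProj_sub_smul, map_smul, defectProj_eq_self_iff.2 (hφ n)]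
    abel
  have hlim := (Q.continuous.tendsto p).comp hxp
  obtain ⟨⟨g, k⟩, hgk, hlim2⟩ := exists_tendsto_of_boundedBelow hS.isClosed
    (-(conj z • ContinuousLinearMap.id ℂ H)) (c := ‖z‖) (norm_pos_iff.2 hz) (by
      intro q hq
      obtain ⟨f, hf1, hf2⟩ := (LinearPMap.mem_graph_iff _).1 hq
      rw [← hf1, ← hf2]
      have := norm_le_norm_sub_smul hS (w := conj z) (by simpa using hre) f
      rwa [sub_eq_add_neg, RCLike.norm_conj] at this)
    (p := fun n => ((f n : H), S (f n))) (fun n => S.mem_graph _) (h := Q p) (by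
      refine hlim.congr fun n => ?_
      rw [Function.comp_apply, hQ, sub_eq_add_neg]
      rfl)
  obtain ⟨f₀, hf₀1, hf₀2⟩ := (LinearPMap.mem_graph_iff _).1 hgk
  dsimp only at hf₀1 hf₀2
  have hfl : Tendsto (fun n => (f n : H)) atTop (𝓝 f₀) := by
    rw [hf₀1]; exact (continuous_fst.tendsto _).comp hlim2
  have hSl : Tendsto (fun n => S (f n)) atTop (𝓝 (S f₀)) := by
    rw [hf₀2]; exact (continuous_snd.tendsto _).comp hlim2
  have hx1 : Tendsto (fun n => (x n).1) atTop (𝓝 p.1) := (continuous_fst.tendsto _).comp hxp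
  have hx2 : Tendsto (fun n => (x n).2) atTop (𝓝 p.2) := (continuous_snd.tendsto _).comp hxp
  have hφl : Tendsto φ atTop (𝓝 (p.1 - f₀)) := by
    refine (hx1.sub hfl).congr fun n => ?_
    rw [h1, add_sub_cancel_left]
  refine (mem_graph_extension hS hz hre).2 ⟨f₀, p.1 - f₀,
    (Submodule.isClosed_orthogonal _).mem_of_tendsto hφl (Eventually.of_forall hφ),
    (add_sub_cancel _ _).symm, tendsto_nhds_unique hx2 ?_⟩
  refine (hSl.sub (hφl.const_smul z)).congr fun n => ?_
  rw [h2]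

/-- The graph of `S_z*` over `dom S_z`. -/
theorem mem_graph_adjoint_extension (f : S.domain) {φ : H} (hφ : φ ∈ defectSpace S z) {w : H} :
    ((f : H) + φ, w) ∈ (extension S hS z hz hre).adjoint.graph ↔
      w = S f + z • φ ∧ conj z • defectProj S z f + (z.re : ℂ) • φ = 0 := by
  have hre2 : (z.re : ℂ) = (z + conj z) / 2 := by rw [Complex.add_conj]; simp
  rw [LinearPMap.adjoint_graph_eq_graph_adjoint (dense_domain_extension hS hz hre),
    Submodule.mem_adjoint_iff]
  constructor
  · intro h
    -- Testing against `dom S` alone already fixes the value of the adjoint.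
    have hw : w = S f + z • φ := by
      refine hS.dense_domain.eq_of_inner_right ℂ fun g hg => ?_
      have h1 := h _ _ ((mem_graph_extension hS hz hre).2
        ⟨⟨g, hg⟩, 0, Submodule.zero_mem _, rfl, rfl⟩)
      have h2 := hS.symmetric ⟨g, hg⟩ f
      have h3 := mem_defectSpace.1 hφ ⟨g, hg⟩
      simp only [add_zero, smul_zero, sub_zero, inner_add_right] at h1 h2 h3
      rw [inner_add_right, inner_smul_right]
      linear_combination h2 + h3 - h1
    refine ⟨hw, ?_⟩
    -- The vector to be shown zero lies in `N_z`, so it can serve as its own test vector.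
    set y := conj z • defectProj S z f + (z.re : ℂ) • φ with hy
    have hyN : y ∈ defectSpace S z := Submodule.add_mem _
      (Submodule.smul_mem _ _ (defectProj_mem _)) (Submodule.smul_mem _ _ hφ)
    have h1 := h _ _ ((mem_graph_extension hS hz hre).2 ⟨0, y, hyN, rfl, rfl⟩)
    rw [← inner_self_eq_zero (𝕜 := ℂ)]
    nth_rewrite 2 [hy]
    have h3 := inner_map_of_mem_defectSpace hyN f
    simp only [LinearPMap.map_zero, zero_sub, ZeroMemClass.coe_zero, zero_add, hw, inner_add_right,
      inner_neg_left, inner_smul_left, inner_smul_right, h3] at h1 ⊢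
    rw [inner_defectProj_right_of_mem hyN, hre2]
    linear_combination (-1 / 2) * h1
  · rintro ⟨rfl, h⟩ a b hab
    obtain ⟨g, ψ, hψ, rfl, rfl⟩ := (mem_graph_extension hS hz hre).1 hab
    have h2 := hS.symmetric g f
    have h3 := mem_defectSpace.1 hφ g
    have h4 := inner_map_of_mem_defectSpace hψ f
    have h5 : conj z * inner ℂ ψ (f : H) + (z + conj z) / 2 * inner ℂ ψ φ = 0 := by
      rw [← hre2, ← inner_defectProj_right_of_mem hψ, ← inner_smul_right, ← inner_smul_right,
        ← inner_add_right, h, inner_zero_right]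
    simp only [inner_add_right, inner_add_left, inner_sub_left, inner_smul_left, inner_smul_right,
      h2, h3, h4]
    linear_combination (-2) * h5

theorem mem_domInter_extension {u : H} : u ∈ domInter (extension S hS z hz hre) ↔
    ∃ f : S.domain, ∃ φ ∈ defectSpace S z, u = f + φ ∧
      conj z • defectProj S z f + (z.re : ℂ) • φ = 0 := by
  constructor
  · rintro ⟨h1, h2⟩
    obtain ⟨f, φ, hφ, rfl, -⟩ := (mem_graph_extension hS hz hre).1
      ((extension S hS z hz hre).mem_graph ⟨u, h1⟩)
    have h3 := (extension S hS z hz hre).adjoint.mem_graph ⟨_, h2⟩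
    exact ⟨f, φ, hφ, rfl, ((mem_graph_adjoint_extension hS hz hre f hφ).1 h3).2⟩
  · rintro ⟨f, φ, hφ, rfl, h⟩
    exact ⟨LinearPMap.mem_domain_of_mem_graph
        ((mem_graph_extension hS hz hre).2 ⟨f, φ, hφ, rfl, rfl⟩),
      LinearPMap.mem_domain_of_mem_graph
        ((mem_graph_adjoint_extension hS hz hre f hφ).2 ⟨rfl, h⟩)⟩

/-- For nonreal `z` the intersection of the domains of `S_z` and `S_z*` is a core of neither. -/
theorem not_hasCore_extension (him : z.im ≠ 0) (hN : defectSpace S z ≠ ⊥) :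
    ¬ (extension S hS z hz hre).HasCore (domInter (extension S hS z hz hre)) ∧
    ¬ (extension S hS z hz hre).adjoint.HasCore (domInter (extension S hS z hz hre)) := by
  have him' : (z.im : ℂ) ≠ 0 := by exact_mod_cast him
  -- The domain condition gives `z̄ P (f + φ) = -i (Im z) φ`, so `z φ = K (f + φ)` with `K = (i |z|²
  -- / Im z) P`; a purely imaginary multiple of `P` is skew-adjoint.
  refine not_hasCore_domInter (extension_isClosed hS hz hre) (dense_domain_extension hS hz hre)
    (extension_accretive hS hz hre) ((Complex.I * z * conj z / z.im) • defectProj S z) ?_ ?_ ?_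
  · intro x y
    rw [smul_apply, smul_apply, inner_smul_left,
      inner_smul_right, inner_defectProj_left]
    simp only [map_div₀, map_mul, Complex.conj_I, Complex.conj_conj, Complex.conj_ofReal]
    ring
  · intro u v w hv hw
    obtain ⟨f, φ, hφ, rfl, rfl⟩ := (mem_graph_extension hS hz hre).1 hv
    obtain ⟨rfl, h⟩ := (mem_graph_adjoint_extension hS hz hre f hφ).1 hw
    have h1 : (conj z) • defectProj S z ((f : H) + φ) = (-Complex.I * z.im) • φ := by
      rw [map_add, defectProj_eq_self_iff.2 hφ, smul_add, eq_neg_of_add_eq_zero_left h,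
        ← neg_smul, ← add_smul]
      congr 1
      apply Complex.ext <;> simp
    have h2 : ((Complex.I * z * conj z / z.im) • defectProj S z) ((f : H) + φ) = z • φ := by
      have e : Complex.I * z * conj z / z.im = Complex.I * z / z.im * conj z := by ring
      rw [smul_apply, e, mul_smul, h1, smul_smul]
      congr 1
      field_simp
      linear_combination (-1 : ℂ) * Complex.I_sq
    rw [h2, two_smul]
    abel
  -- Taking `φ = 0` in the domain condition shows that `P` vanishes on the dense `dom S`.
  · intro hle
    apply hN
    rw [Submodule.eq_bot_iff]
    intro φ hφ
    refine hS.dense_domain.eq_zero_of_inner_right ℂ fun f hf => ?_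
    have h1 := (mem_graph_extension hS hz hre).2
      ⟨⟨f, hf⟩, 0, Submodule.zero_mem _, rfl, rfl⟩
    have h2 := (extension S hS z hz hre).adjoint.mem_graph
      ⟨_, hle (LinearPMap.mem_domain_of_mem_graph h1)⟩
    have h3 := ((mem_graph_adjoint_extension hS hz hre _ (Submodule.zero_mem _)).1 h2).2
    rw [smul_zero, add_zero, smul_eq_zero] at h3
    have h4 := h3.resolve_left (by simpa using hz)
    have h5 := inner_defectProj_left (S := S) (z := z) f φ
    rw [defectProj_eq_self_iff.2 hφ, h4, inner_zero_left] at h5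
    exact h5.symm

end Extension

/-! ### Dimension, codimension and density. -/

theorem dim_eq_top_iff {L : Submodule ℂ H} : dim L = ⊤ ↔ ¬ FiniteDimensional ℂ L := by
  rw [dim, Cardinal.toENat_eq_top, FiniteDimensional, ← Module.rank_lt_aleph0_iff, not_lt]

theorem domain_square (S : H →ₗ.[ℂ] H) : (square S).domain = sqDomain S := by
  refine inf_eq_left.2 ?_
  rintro _ ⟨f, -, rfl⟩
  exact f.2

/-- If `D` is dense and `N` is finite-dimensional, then `D ⊓ Nᗮ` is dense in `Nᗮ`. -/
theorem eq_zero_of_orthogonal_inf {D N : Submodule ℂ H} (hD : Dense (D : Set H))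
    [FiniteDimensional ℂ N] {h : H} (hN : h ∈ Nᗮ) (hh : h ∈ (D ⊓ Nᗮ)ᗮ) : h = 0 := by
  let p : D →ₗ[ℂ] N := N.orthogonalProjectionOnto.toLinearMap ∘ₗ D.subtype
  let g : D →ₗ[ℂ] ℂ := (innerSL ℂ h).toLinearMap ∘ₗ D.subtype
  -- The functional `⟨h, ·⟩` on `D` vanishes on the kernel of the projection to `N`, so it factors
  -- through `N`. As `N` is finite-dimensional the factor is continuous, and the identity extends
  -- from `D` to `H`; evaluation at `h ∈ Nᗮ` gives `⟨h, h⟩ = 0`.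
  have hle : LinearMap.ker p ≤ LinearMap.ker g := by
    intro f hf
    have h1 : (f : H) ∈ Nᗮ := N.orthogonalProjectionOnto_eq_zero_iff.1 hf
    exact (Submodule.mem_orthogonal' _ _).1 hh _ ⟨f.2, h1⟩
  obtain ⟨l, hl⟩ : ∃ l : N →ₗ[ℂ] ℂ, l ∘ₗ p = g := by
    have hg : g ∈ LinearMap.range p.dualMap := by
      rw [LinearMap.range_dualMap_eq_dualAnnihilator_ker, Submodule.mem_dualAnnihilator]
      exact fun f hf => hle hf
    exact hg
  have hext : (fun x => inner ℂ h x) = fun x => l (N.orthogonalProjectionOnto x) := by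
    refine Continuous.ext_on hD (by fun_prop)
      ((LinearMap.continuous_of_finiteDimensional l).comp
        N.orthogonalProjectionOnto.continuous) fun f hf => ?_
    exact (LinearMap.congr_fun hl ⟨f, hf⟩).symm
  have := congrFun hext h
  rw [N.orthogonalProjectionOnto_eq_zero_iff.2 hN, map_zero] at this
  exact inner_self_eq_zero.1 this

variable [CompleteSpace H]

theorem codim_eq_dim_orthogonal (L : Submodule ℂ H) : codim L = dim Lᗮ := by
  have : CompleteSpace L.topologicalClosure :=
    L.isClosed_topologicalClosure.completeSpace_coe
  rw [codim, dim, ← Submodule.orthogonal_closure L]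
  exact congrArg _ (LinearEquiv.rank_eq
    (Submodule.quotientEquivOfIsCompl _ _ (Submodule.isCompl_orthogonal L.topologicalClosure)))

theorem dense_of_orthogonal_eq_bot {L : Submodule ℂ H} (h : Lᗮ = ⊥) : Dense (L : Set H) := by
  rw [Submodule.dense_iff_topologicalClosure_eq_top, Submodule.topologicalClosure_eq_top_iff, h]

/-! ### Density and size of `dom S_z ∩ dom S_z*`. -/

variable {S : H →ₗ.[ℂ] H} {z : ℂ}

theorem mem_orthogonal_domInter_extension (hS : IsClosedNonnegSymmetric S)
    (hz : z ≠ 0) (hre : z.re ≤ 0) (hre0 : z.re ≠ 0) {h : H} :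
    h ∈ (domInter (extension S hS z hz hre))ᗮ ↔ (z.re : ℂ) • h = z • defectProj S z h := by
  have hr : (z.re : ℂ) ≠ 0 := by exact_mod_cast hre0
  have key : ∀ f : S.domain, inner ℂ ((f : H) + -(conj z / z.re) • defectProj S z f) h
      = inner ℂ (f : H) (h - (z / z.re) • defectProj S z h) := by
    intro f
    rw [inner_add_left, inner_smul_left, inner_sub_right, inner_smul_right, inner_defectProj_left]
    simp only [map_neg, map_div₀, Complex.conj_conj, Complex.conj_ofReal]
    ring
  have hiff : (z.re : ℂ) • h = z • defectProj S z h ↔ h - (z / z.re) • defectProj S z h = 0 := by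
    rw [sub_eq_zero, div_eq_inv_mul, mul_smul, eq_inv_smul_iff₀ hr]
  rw [hiff, Submodule.mem_orthogonal]
  constructor
  · intro hh
    refine hS.dense_domain.eq_zero_of_inner_right ℂ fun f hf => ?_
    rw [← key ⟨f, hf⟩]
    refine hh _ ((mem_domInter_extension hS hz hre).2 ⟨⟨f, hf⟩, _,
      Submodule.smul_mem _ _ (defectProj_mem _), rfl, ?_⟩)
    rw [smul_smul, ← add_smul]
    convert zero_smul ℂ _
    field_simp
    ring
  · intro hh u hu
    obtain ⟨f, φ, hφ, rfl, h1⟩ := (mem_domInter_extension hS hz hre).1 hu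
    have h2 : φ = -(conj z / z.re) • defectProj S z f := by
      rw [neg_smul, div_eq_inv_mul, mul_smul, ← smul_neg, ← eq_neg_of_add_eq_zero_right h1,
        inv_smul_smul₀ hr]
    rw [h2, key, hh, inner_zero_right]

/-- Applying `P` to `(Re z) h = z P h` gives `(Re z - z) P h = 0`; hence `P h = 0`, and then `h =
0`. -/
theorem dense_domInter_extension_of_re_ne_zero (hS : IsClosedNonnegSymmetric S)
    (hz : z ≠ 0) (hre : z.re ≤ 0) (hre0 : z.re ≠ 0) (him : z.im ≠ 0) :
    Dense (domInter (extension S hS z hz hre) : Set H) := by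
  refine dense_of_orthogonal_eq_bot ((Submodule.eq_bot_iff _).2 fun h hh => ?_)
  have h1 := (mem_orthogonal_domInter_extension hS hz hre hre0).1 hh
  have h2 := congrArg (defectProj S z) h1
  rw [map_smul, map_smul, defectProj_eq_self_iff.2 (defectProj_mem h), ← sub_eq_zero, ← sub_smul,
    smul_eq_zero] at h2
  have h3 : (z.re : ℂ) - z ≠ 0 := fun h => him (by
    have := congrArg Complex.im h
    simpa using this)
  rw [h2.resolve_left h3, smul_zero, smul_eq_zero] at h1
  exact h1.resolve_left (by exact_mod_cast hre0)

theorem orthogonal_domInter_extension_of_im_eq_zero (hS : IsClosedNonnegSymmetric S)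
    (hz : z ≠ 0) (hre : z.re ≤ 0) (him : z.im = 0) :
    (domInter (extension S hS z hz hre))ᗮ = defectSpace S z := by
  have hzr : (z.re : ℂ) = z := Complex.ext rfl (by simp [him])
  have hre0 : z.re ≠ 0 := fun h => hz (by rw [← hzr, h, Complex.ofReal_zero])
  ext h
  rw [mem_orthogonal_domInter_extension hS hz hre hre0, hzr, ← defectProj_eq_self_iff]
  exact ⟨fun e => (smul_right_injective H hz e).symm, fun e => by rw [e]⟩

theorem domInter_extension_of_re_eq_zero (hS : IsClosedNonnegSymmetric S)
    (hz : z ≠ 0) (hre : z.re ≤ 0) (h0 : z.re = 0) :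
    domInter (extension S hS z hz hre)
      = (S.domain ⊓ (defectSpace S z)ᗮ) ⊔ defectSpace S z := by
  have hc : conj z ≠ 0 := by simpa using hz
  ext u
  rw [mem_domInter_extension, Submodule.mem_sup]
  constructor
  · rintro ⟨f, φ, hφ, rfl, h⟩
    rw [h0, Complex.ofReal_zero, zero_smul, add_zero, smul_eq_zero] at h
    exact ⟨f, ⟨f.2, defectProj_eq_zero_iff.1 (h.resolve_left hc)⟩, φ, hφ, rfl⟩
  · rintro ⟨f, ⟨hf, hf'⟩, φ, hφ, rfl⟩
    exact ⟨⟨f, hf⟩, φ, hφ, rfl, by simp [h0, defectProj_eq_zero_iff.2 hf']⟩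

theorem dense_domInter_extension_of_finiteDimensional (hS : IsClosedNonnegSymmetric S)
    (hz : z ≠ 0) (hre : z.re ≤ 0) (h0 : z.re = 0)
    [FiniteDimensional ℂ (defectSpace S z)] :
    Dense (domInter (extension S hS z hz hre) : Set H) := by
  refine dense_of_orthogonal_eq_bot ((Submodule.eq_bot_iff _).2 fun h hh => ?_)
  rw [domInter_extension_of_re_eq_zero hS hz hre h0] at hh
  exact eq_zero_of_orthogonal_inf hS.dense_domain
    (Submodule.orthogonal_le le_sup_right hh) (Submodule.orthogonal_le le_sup_left hh)

/-- An element of `N_zᗮ` has the form `S g - z̄ g`; if it also lies in `dom S`, then so does `S g`,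
whence `g ∈ dom S²`. -/
theorem domain_inf_orthogonal_defectSpace_eq_bot (hS : IsClosedNonnegSymmetric S)
    (hz : z ≠ 0) (hre : z.re ≤ 0) (hsq : sqDomain S = ⊥) :
    S.domain ⊓ (defectSpace S z)ᗮ = ⊥ := by
  rw [Submodule.eq_bot_iff]
  rintro f ⟨hf, hf'⟩
  rw [← shiftRange_eq_orthogonal hS hz hre] at hf'
  obtain ⟨g, hg⟩ := hf'
  have hg' : S g - conj z • (g : H) = f := hg
  have hSg : S g ∈ S.domain := by
    rw [sub_eq_iff_eq_add.1 hg']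
    exact Submodule.add_mem _ hf (Submodule.smul_mem _ _ g.2)
  have h1 : (g : H) ∈ sqDomain S := ⟨g, hSg, rfl⟩
  rw [hsq, Submodule.mem_bot] at h1
  have h2 : g = 0 := Subtype.ext h1
  rw [← hg', h2]
  simp

/-- If `dom S² = {0}` and `N_z` is nontrivial, then `ran (S - z̄ I)` is infinite-dimensional. -/
theorem not_finiteDimensional_orthogonal_defectSpace (hS : IsClosedNonnegSymmetric S)
    (hz : z ≠ 0) (hre : z.re ≤ 0) (hN : defectSpace S z ≠ ⊥)
    (hsq : sqDomain S = ⊥) : ¬ FiniteDimensional ℂ (defectSpace S z)ᗮ := by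
  intro hfin
  rw [← shiftRange_eq_orthogonal hS hz hre] at hfin
  have hinj : Function.Injective (S.toFun - conj z • S.domain.subtype) := by
    rw [← LinearMap.ker_eq_bot, LinearMap.ker_eq_bot']
    intro f hf
    have h1 := norm_le_norm_sub_smul hS (w := conj z) (by simpa using hre) f
    have hf' : S f - conj z • (f : H) = 0 := hf
    rw [hf', norm_zero, RCLike.norm_conj] at h1
    have h2 : ‖(f : H)‖ = 0 :=
      le_antisymm (nonpos_of_mul_nonpos_right h1 (norm_pos_iff.2 hz)) (norm_nonneg _)
    exact Subtype.ext (norm_eq_zero.1 h2)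
  have hran : FiniteDimensional ℂ (S.toFun - conj z • S.domain.subtype).range := hfin
  -- Since `S - z̄ I` is injective, a finite-dimensional range makes `dom S` finite-dimensional,
  -- hence closed and equal to `H`; then `dom S² = H` as well.
  have hdom : FiniteDimensional ℂ S.domain :=
    LinearEquiv.finiteDimensional (LinearEquiv.ofInjective _ hinj).symm
  have htop : S.domain = ⊤ := by
    rw [← (Submodule.dense_iff_topologicalClosure_eq_top.1 hS.dense_domain)]
    exact (Submodule.closed_of_finiteDimensional S.domain).submodule_topologicalClosure_eq.symm
  apply hN
  rw [Submodule.eq_bot_iff]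
  intro x _
  have hall : ∀ y, y ∈ S.domain := fun y => htop ▸ Submodule.mem_top
  have hx : x ∈ sqDomain S := ⟨⟨x, hall x⟩, hall _, rfl⟩
  rwa [hsq, Submodule.mem_bot] at hx

/-- Under these hypotheses the intersection of the domains is `N_z` itself. Finite dimension would
make it dense, so `N_zᗮ = {0}`, contrary to the infinite dimension of that complement. -/
theorem not_finiteDimensional_defectSpace (hS : IsClosedNonnegSymmetric S)
    (hz : z ≠ 0) (hre : z.re ≤ 0) (h0 : z.re = 0) (hN : defectSpace S z ≠ ⊥)
    (hsq : sqDomain S = ⊥) : ¬ FiniteDimensional ℂ (defectSpace S z) := by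
  intro hfin
  have h1 := dense_domInter_extension_of_finiteDimensional hS hz hre h0
  rw [domInter_extension_of_re_eq_zero hS hz hre h0,
    domain_inf_orthogonal_defectSpace_eq_bot hS hz hre hsq, bot_sup_eq,
    Submodule.dense_iff_topologicalClosure_eq_top, Submodule.topologicalClosure_eq_top_iff] at h1
  refine not_finiteDimensional_orthogonal_defectSpace hS hz hre hN hsq ?_
  rw [h1]
  infer_instance

end UnboundedOp

end

theorem theorem5p6 {H : Type*} [NormedAddCommGroup H] [InnerProductSpace ℂ H] [CompleteSpace H]
    (S : H →ₗ.[ℂ] H) (hS : UnboundedOp.IsClosedNonnegSymmetric S) (hns : ¬ IsSelfAdjoint S)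
    (z : ℂ) (hz : z ≠ 0) (hre : z.re ≤ 0)
    (Sz : H →ₗ.[ℂ] H) (hSz : Sz = UnboundedOp.extension S hS z hz hre) :
    -- the case of negative real part and nonzero imaginary part
    (z.re < 0 → z.im ≠ 0 →
      Dense (UnboundedOp.domInter Sz : Set H) ∧
      ¬ Sz.HasCore (UnboundedOp.domInter Sz) ∧
      ¬ Sz.adjoint.HasCore (UnboundedOp.domInter Sz)) ∧
    -- the case of negative real numbers
    (∀ a : ℝ, a < 0 → z = (a : ℂ) →
      (UnboundedOp.domInter Sz)ᗮ = UnboundedOp.defectSpace S z ∧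
      UnboundedOp.codim (UnboundedOp.domInter Sz) =
        UnboundedOp.dim (UnboundedOp.defectSpace S z)) ∧
    -- the case of nonzero purely imaginary numbers
    (∀ x : ℝ, x ≠ 0 → z = Complex.I * (x : ℂ) →
      (Dense (UnboundedOp.domInter Sz : Set H) →
        ¬ Sz.HasCore (UnboundedOp.domInter Sz) ∧
        ¬ Sz.adjoint.HasCore (UnboundedOp.domInter Sz)) ∧
      (UnboundedOp.dim (UnboundedOp.defectSpace S z) < ⊤ →
        Dense (UnboundedOp.domInter Sz : Set H)) ∧
      ((UnboundedOp.square S).domain = ⊥ →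
        UnboundedOp.dim (UnboundedOp.defectSpace S z) = ⊤ ∧
        UnboundedOp.dim (UnboundedOp.domInter Sz) = ⊤ ∧
        UnboundedOp.codim (UnboundedOp.domInter Sz) = ⊤)) := by
  subst hSz
  have hN : UnboundedOp.defectSpace S z ≠ ⊥ := fun h =>
    hns (UnboundedOp.isSelfAdjoint_of_defectSpace_eq_bot hS hz hre h)
  refine ⟨fun hre0 him => ?_, fun a _ hza => ?_, fun x hx hzx => ?_⟩
  · exact ⟨UnboundedOp.dense_domInter_extension_of_re_ne_zero hS hz hre hre0.ne him,
      UnboundedOp.not_hasCore_extension hS hz hre him hN⟩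
  · have h1 := UnboundedOp.orthogonal_domInter_extension_of_im_eq_zero hS hz hre (by simp [hza])
    exact ⟨h1, by rw [UnboundedOp.codim_eq_dim_orthogonal, h1]⟩
  · have h0 : z.re = 0 := by simp [hzx]
    have him : z.im ≠ 0 := by simpa [hzx] using hx
    refine ⟨fun _ => UnboundedOp.not_hasCore_extension hS hz hre him hN, fun hfin => ?_,
      fun hsq => ?_⟩
    · have : FiniteDimensional ℂ (UnboundedOp.defectSpace S z) :=
        not_not.1 (mt UnboundedOp.dim_eq_top_iff.2 hfin.ne)
      exact UnboundedOp.dense_domInter_extension_of_finiteDimensional hS hz hre h0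
    · rw [UnboundedOp.domain_square] at hsq
      have hinf := UnboundedOp.dim_eq_top_iff.2
        (UnboundedOp.not_finiteDimensional_defectSpace hS hz hre h0 hN hsq)
      rw [UnboundedOp.codim_eq_dim_orthogonal,
        UnboundedOp.domInter_extension_of_re_eq_zero hS hz hre h0,
        UnboundedOp.domain_inf_orthogonal_defectSpace_eq_bot hS hz hre hsq, bot_sup_eq]
      exact ⟨hinf, hinf, UnboundedOp.dim_eq_top_iff.2
        (UnboundedOp.not_finiteDimensional_orthogonal_defectSpace hS hz hre hN hsq)⟩
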